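/- Let $n\ge 1$. A polyhedral cone in $\mathbb R^n$ is the intersection of finitely many (possibly zero) closed halfspaces with the origin in their boundary; let $\mathsf U$ be the family of all finite unions of polyhedral cones in $\mathbb R^n$, including $\emptyset$. A real function $\varphi$ on $\mathsf U$ is additive if $\varphi(\emptyset)=0$ and $\varphi(A\cup B)+\varphi(A\cap B)=\varphi(A)+\varphi(B)$ for all $A,B\in\mathsf U$. For a polyhedral cone $C$, let $C^\circ=\{x:\langle x,y\rangle\le 0 \text{ for all } y\in C\}$, and let the outer angle of $C$ be $\Gamma(C)=\sigma(C^\circ\cap\mathbb S^{n-1})$, where $\sigma$ is the normalized spherical Lebesgue measure on the unit sphere $\mathbb S^{n-1}$. A conic cell complex is a finite set $\mathcal Z$ of polyhedral cones in $\mathbb R^n$ such that each (nonempty) face of a cone of $\mathcal Z$ belongs to $\mathcal Z$ and the intersection of any two cones of $\mathcal Z$ is a face of each of them; put $|\mathcal Z|=\bigcup_{C\in\mathcal Z}C$. The outer angle has an additive extension to $\mathsf U$, and if $\Gamma$ also denotes the additive extension of the outer angle to $\mathsf U$, then for every conic cell complex $\mathcal Z$ in $\mathbb R^n$, $$\Gamma(|\mathcal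 Z|)=\sum_{C\in\mathcal Z}(-1)^{\dim C}\,\Gamma(C).$$ -/

import Mathlib

open MeasureTheory

noncomputable section

namespace ConicComplex

/-- A convex polyhedral cone in `ℝⁿ`: the intersection of a finite (possibly empty) family of
closed halfspaces having the origin in their boundary. -/
def IsPolyhedralCone {n : ℕ} (C : Set (EuclideanSpace ℝ (Fin n))) : Prop :=
  ∃ s : Finset (EuclideanSpace ℝ (Fin n)),
    (∀ u ∈ s, u ≠ 0) ∧ C = {x | ∀ u ∈ s, inner ℝ x u ≤ 0}

/-- The family of all convex polyhedral cones in `ℝⁿ`. -/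
def polyhedralCones (n : ℕ) : Set (Set (EuclideanSpace ℝ (Fin n))) :=
  {C | IsPolyhedralCone C}

/-- All finite unions of members of the family `S`, the empty union `∅` included. -/
def finiteUnions {α : Type*} (S : Set (Set α)) : Set (Set α) :=
  {A | ∃ T : Set (Set α), T.Finite ∧ T ⊆ S ∧ A = ⋃₀ T}

/-- `φ` is additive (a valuation) on the intersection-closed family `S`. Only the values of `φ` on `S` matter. -/
structure IsValuationOn {α : Type*} (S : Set (Set α)) (φ : Set α → ℝ) : Prop where
  union_add_inter : ∀ A ∈ S, ∀ B ∈ S, A ∪ B ∈ S → φ (A ∪ B) + φ (A ∩ B) = φ A + φ B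
  empty : ∅ ∈ S → φ ∅ = 0

/-- The dual cone `C° = {x : ⟨x, y⟩ ≤ 0 for all y ∈ C}`. -/
def dualCone {n : ℕ} (C : Set (EuclideanSpace ℝ (Fin n))) : Set (EuclideanSpace ℝ (Fin n)) :=
  {x | ∀ y ∈ C, inner ℝ x y ≤ 0}

/-- The spherical Lebesgue measure on the unit sphere of `ℝⁿ`, normalized to total mass one. -/
def sphereMeasure (n : ℕ) : Measure (Metric.sphere (0 : EuclideanSpace ℝ (Fin n)) 1) :=
  ((volume : Measure (EuclideanSpace ℝ (Fin n))).toSphere Set.univ)⁻¹ •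
    (volume : Measure (EuclideanSpace ℝ (Fin n))).toSphere

/-- The outer angle `σ(C° ∩ Sⁿ⁻¹)` of a cone `C`. -/
def outerAngle {n : ℕ} (C : Set (EuclideanSpace ℝ (Fin n))) : ℝ :=
  (sphereMeasure n).real {u | (u : EuclideanSpace ℝ (Fin n)) ∈ dualCone C}

/-- `Γ` is an additive extension of the outer angle to the finite unions of polyhedral cones. -/
structure IsOuterAngleExtension {n : ℕ} (Γ : Set (EuclideanSpace ℝ (Fin n)) → ℝ) : Prop where
  isValuationOn : IsValuationOn (finiteUnions (polyhedralCones n)) Γ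
  eq_outerAngle : ∀ C ∈ polyhedralCones n, Γ C = outerAngle C

/-- `F` is a (nonempty) face of the polyhedral cone `C`; the cone itself is one of its faces. -/
def IsFace {n : ℕ} (C F : Set (EuclideanSpace ℝ (Fin n))) : Prop :=
  F.Nonempty ∧ IsExposed ℝ C F

/-- The dimension of a cone, which is the dimension of its linear span. -/
def coneDim {n : ℕ} (C : Set (EuclideanSpace ℝ (Fin n))) : ℕ :=
  Module.finrank ℝ (Submodule.span ℝ C)

/-- A conic cell complex in `ℝⁿ`. -/
structure ConicCellComplex (n : ℕ) where
  /-- the finitely many cells -/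
  cells : Finset (Set (EuclideanSpace ℝ (Fin n)))
  isPolyhedralCone : ∀ C ∈ cells, IsPolyhedralCone C
  face_mem : ∀ C ∈ cells, ∀ F, IsFace C F → F ∈ cells
  inter_isFace : ∀ C ∈ cells, ∀ D ∈ cells, IsFace C (C ∩ D) ∧ IsFace D (C ∩ D)

/-- The underlying space `|Z|`: the union of the cells. -/
def ConicCellComplex.carrier {n : ℕ} (Z : ConicCellComplex n) : Set (EuclideanSpace ℝ (Fin n)) :=
  ⋃ C ∈ Z.cells, C

end ConicComplex

end

/-!
For a vector `u`, consider the part of a set `A` in the closed halfspace `{x | 0 ≤ ⟨x, u⟩}`, and its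
Euler characteristic `χ` with compact supports. The argument rests on the fact that the spherical
mean of `χ(A ∩ {x | 0 ≤ ⟨x, u⟩})` over the unit vectors `u` is an additive function of `A` which
can be evaluated both on closed polyhedral cones and on their relative interiors.

* On a closed polyhedral cone `C` the integrand is, for almost every `u`, the indicator of `u ∈ C°`:
  for `u ∈ C°` outside of the null set `frontier C°` the part in the halfspace is `{0}`, with
  `χ = 1`; for `u ∉ C°` it is a closed convex cone other than a linear subspace, and such a cone is
  a union of parallel closed halflines, so `χ = 0` (`eulerChar_halfSpaces_eq_zero`). Hence the mean
  is the outer angle, and it is an additive extension of it (`meanEulerChar`).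
* On the relative interior `R` of a polyhedral cone `C` the integrand is `(-1) ^ dim C` if
  `-u ∈ C°`, and `0` otherwise: if an open halfspace meets `R`, then it cuts off a cell of the same
  dimension, so that the rest of `R` has `χ = 0` (`eulerChar_cell_inter_nonneg`). The spherical
  measure is invariant under `u ↦ -u`, so the mean is `(-1) ^ dim C * Γ(C)`.

The carrier of a complex is the disjoint union of the relative interiors of its cells
(`ConicCellComplex.carrier_eq`), so the second computation gives the formula for this extension. By
inclusion-exclusion it is the only one (`IsOuterAngleExtension.eq_biUnion`).

The Euler characteristic is constructed on all sets in which membership is determined by the signs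
of the inner products with finitely many vectors. The hyperplanes orthogonal to these vectors cut
such a set into relatively open convex cells, and `χ` is the sum of `(-1) ^ dim` over the cells. It
does not depend on the hyperplanes because a further hyperplane which meets a cell transversally
replaces `(-1) ^ d` by `(-1) ^ d - (-1) ^ d + (-1) ^ d` (`IsCell.sum_cellSign`).
-/

namespace ConicComplex

section EulerCharacteristic

variable {E : Type*} [NormedAddCommGroup E] [InnerProductSpace ℝ E]

/-! ### Relatively open convex cells -/

/-- The points `x` for which `⟨x, h⟩` has sign `σ`: an open halfspace or a hyperplane (or, when
`h = 0`, everything or nothing). -/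
def signRegion (h : E) (σ : SignType) : Set E := {x | SignType.sign (inner ℝ x h) = σ}

lemma mem_signRegion {h x : E} {σ : SignType} :
    x ∈ signRegion h σ ↔ SignType.sign (inner ℝ x h) = σ := Iff.rfl

lemma mem_signRegion_one {h x : E} : x ∈ signRegion h 1 ↔ 0 < inner ℝ x h := sign_eq_one_iff

lemma mem_signRegion_zero {h x : E} : x ∈ signRegion h 0 ↔ inner ℝ x h = 0 := sign_eq_zero_iff

lemma mem_signRegion_neg_one {h x : E} : x ∈ signRegion h (-1) ↔ inner ℝ x h < 0 :=
  sign_eq_neg_one_iff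

lemma sum_signType (f : SignType → ℝ) : ∑ σ, f σ = f 1 + f 0 + f (-1) := by
  have h : (Finset.univ : Finset SignType) = {1, 0, -1} := by decide
  rw [h, Finset.sum_insert (by decide), Finset.sum_insert (by decide), Finset.sum_singleton,
    add_assoc]

/-- A cell: a convex set which is open relative to a linear subspace. The empty set is a cell. -/
def IsCell (P : Set E) : Prop :=
  ∃ (W : Submodule ℝ E) (O : Set E), IsOpen O ∧ Convex ℝ O ∧ P = (W : Set E) ∩ O

open Classical in
/-- The Euler characteristic with compact supports of a cell: `(-1) ^ dim P`, and `0` for the empty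
cell. -/
noncomputable def cellSign (P : Set E) : ℝ :=
  if P.Nonempty then (-1) ^ Module.finrank ℝ (Submodule.span ℝ P) else 0

@[simp] lemma cellSign_empty : cellSign (∅ : Set E) = 0 := by simp [cellSign]

lemma cellSign_of_nonempty {P : Set E} (hP : P.Nonempty) :
    cellSign P = (-1) ^ Module.finrank ℝ (Submodule.span ℝ P) := if_pos hP

lemma isCell_empty : IsCell (∅ : Set E) :=
  ⟨⊥, ∅, isOpen_empty, convex_empty, by simp⟩

lemma isCell_univ : IsCell (Set.univ : Set E) :=
  ⟨⊤, Set.univ, isOpen_univ, convex_univ, by simp⟩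

lemma isCell_zero : IsCell ({0} : Set E) :=
  ⟨⊥, Set.univ, isOpen_univ, convex_univ, by simp⟩

/-- From a point of a relatively open set one can move a little in both directions along any vector
of the ambient subspace. -/
lemma exists_pos_add_smul_mem {W : Submodule ℝ E} {O : Set E} (hO : IsOpen O) {x w : E}
    (hx : x ∈ (W : Set E) ∩ O) (hw : w ∈ W) :
    ∃ ε : ℝ, 0 < ε ∧ x + ε • w ∈ (W : Set E) ∩ O ∧ x - ε • w ∈ (W : Set E) ∩ O := by
  have hc : Continuous fun t : ℝ => x + t • w := by fun_prop
  have hmem : (fun t : ℝ => x + t • w) ⁻¹' O ∈ nhds (0 : ℝ) :=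
    (hO.preimage hc).mem_nhds (by simpa using hx.2)
  obtain ⟨δ, hδ, hball⟩ := Metric.mem_nhds_iff.1 hmem
  have key : ∀ t : ℝ, |t| < δ → x + t • w ∈ (W : Set E) ∩ O := fun t ht =>
    ⟨W.add_mem hx.1 (W.smul_mem _ hw), hball (by simpa using ht)⟩
  refine ⟨δ / 2, by positivity, key _ ?_, ?_⟩
  · rw [abs_of_pos (by positivity)]; linarith
  · have := key (-(δ / 2)) (by rw [abs_neg, abs_of_pos (by positivity)]; linarith)
    simpa [neg_smul, sub_eq_add_neg] using this

lemma span_inter_of_isOpen {W : Submodule ℝ E} {O : Set E} (hO : IsOpen O)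
    (hne : ((W : Set E) ∩ O).Nonempty) : Submodule.span ℝ ((W : Set E) ∩ O) = W := by
  apply le_antisymm (Submodule.span_le.2 Set.inter_subset_left)
  intro w hw
  obtain ⟨x, hx⟩ := hne
  obtain ⟨ε, hε, h₁, -⟩ := exists_pos_add_smul_mem hO hx hw
  have h₂ := Submodule.sub_mem (Submodule.span ℝ ((W : Set E) ∩ O)) (Submodule.subset_span h₁)
    (Submodule.subset_span hx)
  rw [add_sub_cancel_left] at h₂
  have h₃ := Submodule.smul_mem _ ε⁻¹ h₂
  rwa [smul_smul, inv_mul_cancel₀ hε.ne', one_smul] at h₃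

lemma cellSign_inter_of_isOpen {W : Submodule ℝ E} {O : Set E} (hO : IsOpen O)
    (hne : ((W : Set E) ∩ O).Nonempty) :
    cellSign ((W : Set E) ∩ O) = (-1) ^ Module.finrank ℝ W := by
  rw [cellSign_of_nonempty hne, span_inter_of_isOpen hO hne]

lemma isOpen_signRegion (h : E) {σ : SignType} (hσ : σ ≠ 0) : IsOpen (signRegion h σ) := by
  have hc : Continuous fun x : E => (inner ℝ x h : ℝ) := by fun_prop
  cases σ with
  | zero => exact absurd rfl hσ
  | neg =>
    have : signRegion h SignType.neg = {x | inner ℝ x h < 0} := by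
      ext x; exact mem_signRegion_neg_one
    rw [this]; exact isOpen_lt hc continuous_const
  | pos =>
    have : signRegion h SignType.pos = {x | 0 < inner ℝ x h} := by
      ext x; exact mem_signRegion_one
    rw [this]; exact isOpen_lt continuous_const hc

lemma convex_signRegion (h : E) (σ : SignType) : Convex ℝ (signRegion h σ) := by
  have hl : IsLinearMap ℝ fun x : E => (inner ℝ x h : ℝ) :=
    ⟨fun x y => inner_add_left x y h, fun c x => real_inner_smul_left x h c⟩
  cases σ with
  | zero =>
    have : signRegion h SignType.zero = {x | inner ℝ x h = 0} := by
      ext x; exact mem_signRegion_zero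
    rw [this]; exact convex_hyperplane hl 0
  | neg =>
    have : signRegion h SignType.neg = {x | inner ℝ x h < 0} := by
      ext x; exact mem_signRegion_neg_one
    rw [this]; exact convex_halfSpace_lt hl 0
  | pos =>
    have : signRegion h SignType.pos = {x | 0 < inner ℝ x h} := by
      ext x; exact mem_signRegion_one
    rw [this]; exact convex_halfSpace_gt hl 0

lemma inter_inter_signRegion_zero (W : Submodule ℝ E) (O : Set E) (h : E) :
    ((W : Set E) ∩ O) ∩ signRegion h 0 =
      ((W ⊓ LinearMap.ker (innerₛₗ ℝ h) : Submodule ℝ E) : Set E) ∩ O := by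
  ext x
  simp only [Set.mem_inter_iff, mem_signRegion_zero, Submodule.coe_inf, SetLike.mem_coe,
    LinearMap.mem_ker, innerₛₗ_apply_apply, real_inner_comm x h]
  tauto

lemma IsCell.inter_signRegion {P : Set E} (hP : IsCell P) (h : E) (σ : SignType) :
    IsCell (P ∩ signRegion h σ) := by
  obtain ⟨W, O, hO, hc, rfl⟩ := hP
  rcases eq_or_ne σ 0 with rfl | hσ
  · exact ⟨_, O, hO, hc, inter_inter_signRegion_zero W O h⟩
  · exact ⟨W, O ∩ signRegion h σ, hO.inter (isOpen_signRegion h hσ),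
      hc.inter (convex_signRegion h σ), Set.inter_assoc _ _ _⟩

/-- Cutting a cell by an open halfspace does not change its dimension. -/
lemma IsCell.cellSign_inter_signRegion {P : Set E} (hP : IsCell P) {h : E} {σ : SignType}
    (hσ : σ ≠ 0) (hne : (P ∩ signRegion h σ).Nonempty) :
    cellSign (P ∩ signRegion h σ) = cellSign P := by
  obtain ⟨W, O, hO, -, rfl⟩ := hP
  rw [cellSign_inter_of_isOpen hO (hne.mono Set.inter_subset_left)]
  rw [Set.inter_assoc] at hne ⊢
  exact cellSign_inter_of_isOpen (hO.inter (isOpen_signRegion h hσ)) hne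

lemma finrank_inf_ker_inner [FiniteDimensional ℝ E] (W : Submodule ℝ E) {h w : E} (hw : w ∈ W)
    (hwh : (inner ℝ w h : ℝ) ≠ 0) :
    Module.finrank ℝ (W ⊓ LinearMap.ker (innerₛₗ ℝ h) : Submodule ℝ E) + 1 =
      Module.finrank ℝ W := by
  have hsurj : LinearMap.range ((innerₛₗ ℝ h).domRestrict W) = ⊤ := by
    apply LinearMap.range_eq_top.2
    apply LinearMap.surjective
    intro h0
    apply hwh
    have := LinearMap.congr_fun h0 ⟨w, hw⟩
    simpa [real_inner_comm] using this
  have h1 := LinearMap.finrank_range_add_finrank_ker ((innerₛₗ ℝ h).domRestrict W)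
  rw [hsurj, finrank_top, Module.finrank_self] at h1
  have h2 : LinearMap.ker ((innerₛₗ ℝ h).domRestrict W) =
      (LinearMap.ker (innerₛₗ ℝ h)).comap W.subtype := rfl
  have h3 := Submodule.finrank_map_subtype_eq W ((LinearMap.ker (innerₛₗ ℝ h)).comap W.subtype)
  rw [Submodule.map_comap_subtype] at h3
  rw [h3, ← h2]
  omega

/-- If the hyperplane `h = 0` meets the cell transversally, then it leaves a piece of the cell on
either side, and the piece in the hyperplane has one dimension less than the cell. -/
lemma cellSign_split_of_mem [FiniteDimensional ℝ E] {W : Submodule ℝ E} {O : Set E}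
    (hO : IsOpen O) {h w x : E} (hw : w ∈ W) (hwh : (inner ℝ w h : ℝ) ≠ 0)
    (hx : x ∈ (W : Set E) ∩ O) (hxh : (inner ℝ x h : ℝ) = 0) :
    (((W : Set E) ∩ O) ∩ signRegion h 1).Nonempty ∧
    (((W : Set E) ∩ O) ∩ signRegion h (-1)).Nonempty ∧
    cellSign (((W : Set E) ∩ O) ∩ signRegion h 0) = -cellSign ((W : Set E) ∩ O) := by
  obtain ⟨ε, hε, h₁, h₂⟩ := exists_pos_add_smul_mem hO hx hw
  have e₁ : (inner ℝ (x + ε • w) h : ℝ) = ε * inner ℝ w h := by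
    rw [inner_add_left, real_inner_smul_left, hxh, zero_add]
  have e₂ : (inner ℝ (x - ε • w) h : ℝ) = -(ε * inner ℝ w h) := by
    rw [inner_sub_left, real_inner_smul_left, hxh, zero_sub]
  refine ⟨?_, ?_, ?_⟩
  · rcases lt_or_gt_of_ne hwh with hneg | hpos
    · exact ⟨_, h₂, mem_signRegion_one.2 (by rw [e₂]; nlinarith)⟩
    · exact ⟨_, h₁, mem_signRegion_one.2 (by rw [e₁]; positivity)⟩
  · rcases lt_or_gt_of_ne hwh with hneg | hpos
    · exact ⟨_, h₁, mem_signRegion_neg_one.2 (by rw [e₁]; nlinarith)⟩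
    · exact ⟨_, h₂, mem_signRegion_neg_one.2 (by rw [e₂]; nlinarith)⟩
  · have hne : (((W : Set E) ∩ O) ∩ signRegion h 0).Nonempty :=
      ⟨x, hx, mem_signRegion_zero.2 hxh⟩
    rw [inter_inter_signRegion_zero] at hne ⊢
    rw [cellSign_inter_of_isOpen hO hne, cellSign_inter_of_isOpen hO ⟨x, hx⟩,
      ← finrank_inf_ker_inner W hw hwh, pow_succ]
    ring

/-- On a convex set missing the hyperplane `h = 0`, the sign of `⟨·, h⟩` is constant. -/
lemma sign_inner_eq_of_convex {P : Set E} (hP : Convex ℝ P) {h : E}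
    (h0 : ∀ x ∈ P, (inner ℝ x h : ℝ) ≠ 0) {x y : E} (hx : x ∈ P) (hy : y ∈ P) :
    SignType.sign (inner ℝ x h : ℝ) = SignType.sign (inner ℝ y h : ℝ) := by
  have aux : ∀ a ∈ P, ∀ b ∈ P, (inner ℝ a h : ℝ) < 0 → ¬ 0 < (inner ℝ b h : ℝ) := by
    intro a ha b hb hna hpb
    have hd : (0 : ℝ) < inner ℝ b h - inner ℝ a h := by linarith
    refine h0 ((inner ℝ b h / (inner ℝ b h - inner ℝ a h) : ℝ) • a +
      (-inner ℝ a h / (inner ℝ b h - inner ℝ a h) : ℝ) • b) (hP ha hb ?_ ?_ ?_) ?_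
    · positivity
    · exact div_nonneg (by linarith) hd.le
    · field_simp; ring
    · rw [inner_add_left, real_inner_smul_left, real_inner_smul_left]
      field_simp; ring
  rcases lt_or_gt_of_ne (h0 x hx) with h1 | h1 <;> rcases lt_or_gt_of_ne (h0 y hy) with h2 | h2
  · rw [sign_neg h1, sign_neg h2]
  · exact absurd h2 (aux x hx y hy h1)
  · exact absurd h1 (aux y hy x hx h2)
  · rw [sign_pos h1, sign_pos h2]

lemma sum_cellSign_inter_of_subset {P : Set E} {h : E} {σ : SignType}
    (hP : P ⊆ signRegion h σ) : ∑ τ, cellSign (P ∩ signRegion h τ) = cellSign P := by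
  rw [Finset.sum_eq_single σ, Set.inter_eq_left.2 hP]
  · intro τ _ hτ
    have : P ∩ signRegion h τ = ∅ := by
      ext x
      simp only [Set.mem_inter_iff, Set.mem_empty_iff_false, iff_false, not_and]
      intro hx hx'
      exact hτ ((mem_signRegion.1 hx').symm.trans (mem_signRegion.1 (hP hx)))
    rw [this, cellSign_empty]
  · simp

/-- The signs of cells are additive under cutting along a hyperplane. -/
lemma IsCell.sum_cellSign [FiniteDimensional ℝ E] {P : Set E} (hP : IsCell P) (h : E) :
    ∑ σ, cellSign (P ∩ signRegion h σ) = cellSign P := by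
  rcases P.eq_empty_or_nonempty with rfl | ⟨x, hx⟩
  · simp
  obtain ⟨W, O, hO, hc, rfl⟩ := id hP
  by_cases hW : ∀ w ∈ W, (inner ℝ w h : ℝ) = 0
  · exact sum_cellSign_inter_of_subset (σ := 0) fun y hy => mem_signRegion_zero.2 (hW y hy.1)
  push Not at hW
  obtain ⟨w, hw, hwh⟩ := hW
  by_cases h0 : ∃ y ∈ (W : Set E) ∩ O, (inner ℝ y h : ℝ) = 0
  · obtain ⟨y, hy, hyh⟩ := h0
    obtain ⟨h₁, h₂, h₃⟩ := cellSign_split_of_mem hO hw hwh hy hyh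
    rw [sum_signType, hP.cellSign_inter_signRegion (by decide) h₁,
      hP.cellSign_inter_signRegion (by decide) h₂, h₃]
    ring
  · push Not at h0
    exact sum_cellSign_inter_of_subset (σ := SignType.sign (inner ℝ x h : ℝ)) fun y hy =>
      sign_inner_eq_of_convex (W.convex.inter hc) h0 hy hx

/-! ### The Euler characteristic of finite unions of cells -/

/-- The sum of `cellSign` over the pieces into which the hyperplanes orthogonal to the vectors of a
list cut the set `A`. It is meaningful when all these pieces are cells. -/
noncomputable def cutSum : List E → Set E → ℝ
  | [], A => cellSign A
  | h :: l, A => ∑ σ, cutSum l (A ∩ signRegion h σ)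

/-- The hyperplanes orthogonal to the vectors of the list cut `A` into cells. -/
def CutsIntoCells : List E → Set E → Prop
  | [], A => IsCell A
  | h :: l, A => ∀ σ, CutsIntoCells l (A ∩ signRegion h σ)

lemma CutsIntoCells.inter_signRegion {l : List E} {A : Set E} (hA : CutsIntoCells l A) (h : E)
    (σ : SignType) : CutsIntoCells l (A ∩ signRegion h σ) := by
  induction l generalizing A with
  | nil => exact IsCell.inter_signRegion hA h σ
  | cons k l ih =>
    intro τ
    rw [Set.inter_right_comm]
    exact ih (hA τ)

/-- Within `P`, membership in `A` depends only on the signs of the inner products with the vectors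
of the list `l`. -/
def SignDetermined (l : List E) (P A : Set E) : Prop :=
  ∀ x ∈ P, ∀ y ∈ P, (∀ h ∈ l, SignType.sign (inner ℝ x h : ℝ) = SignType.sign (inner ℝ y h : ℝ)) →
    (x ∈ A ↔ y ∈ A)

lemma SignDetermined.mono {l l' : List E} {P P' A : Set E} (hA : SignDetermined l P A)
    (hl : l ⊆ l') (hP : P' ⊆ P) : SignDetermined l' P' A :=
  fun x hx y hy h => hA x (hP hx) y (hP hy) fun k hk => h k (hl hk)

lemma SignDetermined.tail {h : E} {l : List E} {P A : Set E} (hA : SignDetermined (h :: l) P A)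
    (σ : SignType) : SignDetermined l (P ∩ signRegion h σ) A := by
  intro x hx y hy hxy
  refine hA x hx.1 y hy.1 fun k hk => ?_
  rcases List.mem_cons.1 hk with rfl | hk
  · exact (mem_signRegion.1 hx.2).trans (mem_signRegion.1 hy.2).symm
  · exact hxy k hk

lemma SignDetermined.eq_empty_or_eq {P A : Set E} (hA : SignDetermined [] P A) :
    P ∩ A = ∅ ∨ P ∩ A = P := by
  rcases (P ∩ A).eq_empty_or_nonempty with h | ⟨x, hx, hxA⟩
  · exact Or.inl h
  · exact Or.inr (Set.inter_eq_left.2 fun y hy => (hA x hx y hy (by simp)).1 hxA)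

lemma SignDetermined.union {l : List E} {P A B : Set E} (hA : SignDetermined l P A)
    (hB : SignDetermined l P B) : SignDetermined l P (A ∪ B) :=
  fun x hx y hy h => or_congr (hA x hx y hy h) (hB x hx y hy h)

lemma SignDetermined.inter {l : List E} {P A B : Set E} (hA : SignDetermined l P A)
    (hB : SignDetermined l P B) : SignDetermined l P (A ∩ B) :=
  fun x hx y hy h => and_congr (hA x hx y hy h) (hB x hx y hy h)

lemma signDetermined_signRegion (h : E) (σ : SignType) :
    SignDetermined [h] Set.univ (signRegion h σ) := by
  intro x _ y _ hxy
  rw [mem_signRegion, mem_signRegion, hxy h (by simp)]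

lemma signDetermined_halfSpaces (s : Finset E) :
    SignDetermined s.toList Set.univ {x | ∀ u ∈ s, (inner ℝ x u : ℝ) ≤ 0} := by
  intro x _ y _ hxy
  refine forall₂_congr fun u hu => ?_
  rw [← sign_nonpos_iff, hxy u (Finset.mem_toList.2 hu), sign_nonpos_iff]

lemma SignDetermined.cutsIntoCells {l : List E} {P A : Set E} (hA : SignDetermined l P A)
    (hP : IsCell P) : CutsIntoCells l (P ∩ A) := by
  induction l generalizing P with
  | nil =>
    rcases hA.eq_empty_or_eq with h | h <;> rw [h]
    · exact isCell_empty
    · exact hP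
  | cons h l ih =>
    intro σ
    rw [Set.inter_right_comm]
    exact ih (hA.tail σ) (hP.inter_signRegion h σ)

/-- Cutting by the hyperplanes orthogonal to the vectors of `l` reduces statements about
sign-determined sets to statements about cells. -/
lemma SignDetermined.induction {p q : Set E → Prop} {l : List E} {P A : Set E}
    (hA : SignDetermined l P A) (hP : q P)
    (hq : ∀ P, q P → ∀ k ∈ l, ∀ σ, q (P ∩ signRegion k σ)) (h0 : p ∅)
    (hcell : ∀ P, q P → p P) (hsplit : ∀ X, ∀ k ∈ l, (∀ σ, p (X ∩ signRegion k σ)) → p X) :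
    p (P ∩ A) := by
  induction l generalizing P with
  | nil =>
    rcases hA.eq_empty_or_eq with h | h <;> rw [h]
    · exact h0
    · exact hcell P hP
  | cons h l ih =>
    refine hsplit _ h (by simp) fun σ => ?_
    rw [Set.inter_right_comm]
    exact ih (hA.tail σ) (hq P hP h (by simp) σ)
      (fun P hP k hk => hq P hP k (List.mem_cons_of_mem _ hk))
      (fun X k hk => hsplit X k (List.mem_cons_of_mem _ hk))

lemma cutSum_union_add_inter {l : List E} {P A B : Set E} (hA : SignDetermined l P A)
    (hB : SignDetermined l P B) :
    cutSum l (P ∩ (A ∪ B)) + cutSum l (P ∩ (A ∩ B)) = cutSum l (P ∩ A) + cutSum l (P ∩ B) := by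
  induction l generalizing P with
  | nil =>
    rw [Set.inter_union_distrib_left, Set.inter_inter_distrib_left]
    rcases hA.eq_empty_or_eq with h | h <;> rcases hB.eq_empty_or_eq with h' | h' <;>
      rw [h, h'] <;> simp [cutSum, add_comm]
  | cons h l ih =>
    simp only [cutSum, ← Finset.sum_add_distrib]
    refine Finset.sum_congr rfl fun σ _ => ?_
    simp only [Set.inter_right_comm P _ (signRegion h σ)]
    exact ih (hA.tail σ) (hB.tail σ)

/-- The finite unions of relatively open polyhedral cones: the sets such that membership in them
depends only on the signs of the inner products with finitely many vectors. -/
def IsConicConstructible (A : Set E) : Prop := ∃ l : List E, SignDetermined l Set.univ A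

lemma isConicConstructible_empty : IsConicConstructible (∅ : Set E) :=
  ⟨[], fun _ _ _ _ _ => Iff.rfl⟩

lemma isConicConstructible_univ : IsConicConstructible (Set.univ : Set E) :=
  ⟨[], fun _ _ _ _ _ => Iff.rfl⟩

lemma isConicConstructible_signRegion (h : E) (σ : SignType) :
    IsConicConstructible (signRegion h σ) := ⟨[h], signDetermined_signRegion h σ⟩

lemma isConicConstructible_nonneg (h : E) :
    IsConicConstructible {x : E | (0 : ℝ) ≤ inner ℝ x h} := by
  refine ⟨[h], fun x _ y _ hxy => ?_⟩
  rw [Set.mem_ofPred_eq, Set.mem_ofPred_eq, ← sign_nonneg_iff, hxy h (by simp), sign_nonneg_iff]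

lemma isConicConstructible_halfSpaces (s : Finset E) :
    IsConicConstructible {x | ∀ u ∈ s, (inner ℝ x u : ℝ) ≤ 0} := ⟨_, signDetermined_halfSpaces s⟩

lemma IsConicConstructible.union {A B : Set E} (hA : IsConicConstructible A)
    (hB : IsConicConstructible B) : IsConicConstructible (A ∪ B) := by
  obtain ⟨l, hl⟩ := hA
  obtain ⟨l', hl'⟩ := hB
  exact ⟨l ++ l', (hl.mono (List.subset_append_left _ _) subset_rfl).union
    (hl'.mono (List.subset_append_right _ _) subset_rfl)⟩

lemma IsConicConstructible.inter {A B : Set E} (hA : IsConicConstructible A)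
    (hB : IsConicConstructible B) : IsConicConstructible (A ∩ B) := by
  obtain ⟨l, hl⟩ := hA
  obtain ⟨l', hl'⟩ := hB
  exact ⟨l ++ l', (hl.mono (List.subset_append_left _ _) subset_rfl).inter
    (hl'.mono (List.subset_append_right _ _) subset_rfl)⟩

lemma IsConicConstructible.biUnion {ι : Type*} (t : Finset ι) {A : ι → Set E}
    (hA : ∀ i ∈ t, IsConicConstructible (A i)) : IsConicConstructible (⋃ i ∈ t, A i) := by
  classical
  induction t using Finset.induction_on with
  | empty => simpa using isConicConstructible_empty
  | insert a t _ ih =>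
    rw [Finset.set_biUnion_insert]
    exact (hA a (by simp)).union (ih fun i hi => hA i (Finset.mem_insert_of_mem hi))

open Classical in
/-- The Euler characteristic with compact supports of a finite union of relatively open polyhedral
cones; the value is `0` on all other sets. -/
noncomputable def eulerChar (A : Set E) : ℝ :=
  if h : IsConicConstructible A then cutSum h.choose A else 0

variable [FiniteDimensional ℝ E]

lemma CutsIntoCells.sum_cutSum {l : List E} {A : Set E} (hA : CutsIntoCells l A) (h : E) :
    ∑ σ, cutSum l (A ∩ signRegion h σ) = cutSum l A := by
  induction l generalizing A with
  | nil => exact IsCell.sum_cellSign hA h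
  | cons k l ih =>
    simp only [cutSum]
    rw [Finset.sum_comm]
    refine Finset.sum_congr rfl fun τ _ => ?_
    rw [← ih (hA τ)]
    simp only [Set.inter_right_comm]

lemma CutsIntoCells.cutSum_append_left {l : List E} {A : Set E} (hA : CutsIntoCells l A)
    (l' : List E) : cutSum (l' ++ l) A = cutSum l A := by
  induction l' generalizing A with
  | nil => rfl
  | cons h l' ih =>
    rw [← hA.sum_cutSum h]
    exact Finset.sum_congr rfl fun σ _ => ih (hA.inter_signRegion h σ)

lemma CutsIntoCells.cutSum_append_right {l : List E} {A : Set E} (hA : CutsIntoCells l A)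
    (l' : List E) : cutSum (l ++ l') A = cutSum l A := by
  induction l generalizing A with
  | nil =>
    have := CutsIntoCells.cutSum_append_left (l := []) hA l'
    rwa [List.append_nil] at this
  | cons h l ih => exact Finset.sum_congr rfl fun σ _ => ih (hA σ)

/-- The sum over the pieces does not depend on the arrangement of hyperplanes. -/
lemma CutsIntoCells.cutSum_eq {l l' : List E} {A : Set E} (hA : CutsIntoCells l A)
    (hA' : CutsIntoCells l' A) : cutSum l A = cutSum l' A := by
  rw [← hA.cutSum_append_right l', hA'.cutSum_append_left l]


lemma IsConicConstructible.eulerChar_eq {A : Set E} (hA : IsConicConstructible A) {l : List E}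
    (hl : CutsIntoCells l A) : eulerChar A = cutSum l A := by
  have h := hA.choose_spec.cutsIntoCells isCell_univ
  rw [Set.univ_inter] at h
  rw [eulerChar, dif_pos hA]
  exact h.cutSum_eq hl

lemma SignDetermined.eulerChar_eq {A : Set E} {l : List E} (hl : SignDetermined l Set.univ A) :
    eulerChar A = cutSum l A := by
  have h := hl.cutsIntoCells isCell_univ
  rw [Set.univ_inter] at h
  exact IsConicConstructible.eulerChar_eq ⟨l, hl⟩ h

lemma IsCell.eulerChar_eq {P : Set E} (hP : IsCell P) (hP' : IsConicConstructible P) :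
    eulerChar P = cellSign P := hP'.eulerChar_eq (l := []) hP

@[simp] lemma eulerChar_empty : eulerChar (∅ : Set E) = 0 := by
  rw [isCell_empty.eulerChar_eq isConicConstructible_empty, cellSign_empty]

lemma eulerChar_zero : eulerChar ({0} : Set E) = 1 := by
  have h : IsConicConstructible ({0} : Set E) := by
    classical
    let b := stdOrthonormalBasis ℝ E
    refine ⟨List.ofFn b, fun x _ y _ hxy => ?_⟩
    have key : ∀ z : E, z ∈ ({0} : Set E) ↔
        ∀ i, SignType.sign (inner ℝ z (b i) : ℝ) = 0 := by
      intro z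
      simp only [Set.mem_singleton_iff, sign_eq_zero_iff]
      refine ⟨fun hz i => by simp [hz], fun hz => ?_⟩
      rw [← b.sum_repr' z]
      exact Finset.sum_eq_zero fun i _ => by rw [real_inner_comm, hz i, zero_smul]
    rw [key, key]
    refine forall_congr' fun i => ?_
    rw [hxy (b i) (by simp)]
  rw [isCell_zero.eulerChar_eq h, cellSign_of_nonempty (Set.singleton_nonempty _),
    Submodule.span_zero_singleton, finrank_bot, pow_zero]

lemma IsConicConstructible.eulerChar_union_add_inter {A B : Set E} (hA : IsConicConstructible A)
    (hB : IsConicConstructible B) :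
    eulerChar (A ∪ B) + eulerChar (A ∩ B) = eulerChar A + eulerChar B := by
  obtain ⟨l, hl⟩ := hA
  obtain ⟨l', hl'⟩ := hB
  have h := hl.mono (List.subset_append_left l l') subset_rfl
  have h' := hl'.mono (List.subset_append_right l l') subset_rfl
  rw [(h.union h').eulerChar_eq, (h.inter h').eulerChar_eq, h.eulerChar_eq, h'.eulerChar_eq]
  simpa using cutSum_union_add_inter h h'

lemma eulerChar_biUnion {ι : Type*} (t : Finset ι) {A : ι → Set E}
    (hA : ∀ i ∈ t, IsConicConstructible (A i))
    (hd : ∀ i ∈ t, ∀ j ∈ t, i ≠ j → Disjoint (A i) (A j)) :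
    eulerChar (⋃ i ∈ t, A i) = ∑ i ∈ t, eulerChar (A i) := by
  classical
  induction t using Finset.induction_on with
  | empty => simp
  | insert a t ha ih =>
    have hA' : ∀ i ∈ t, IsConicConstructible (A i) := fun i hi =>
      hA i (Finset.mem_insert_of_mem hi)
    have hdisj : A a ∩ ⋃ i ∈ t, A i = ∅ := by
      rw [← Set.disjoint_iff_inter_eq_empty, Set.disjoint_iUnion₂_right]
      intro i hi
      exact hd a (by simp) i (Finset.mem_insert_of_mem hi) (by rintro rfl; exact ha hi)
    have h := (hA a (by simp)).eulerChar_union_add_inter (IsConicConstructible.biUnion t hA')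
    rw [hdisj, eulerChar_empty, add_zero] at h
    rw [Finset.set_biUnion_insert, Finset.sum_insert ha, h, ih hA' fun i hi j hj =>
      hd i (Finset.mem_insert_of_mem hi) j (Finset.mem_insert_of_mem hj)]

lemma IsConicConstructible.sum_eulerChar {A : Set E} (hA : IsConicConstructible A) (h : E) :
    ∑ σ, eulerChar (A ∩ signRegion h σ) = eulerChar A := by
  obtain ⟨l, hl⟩ := id hA
  have hc := hl.cutsIntoCells isCell_univ
  rw [Set.univ_inter] at hc
  rw [hA.eulerChar_eq hc, ← hc.sum_cutSum h]
  exact Finset.sum_congr rfl fun σ _ =>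
    (hA.inter (isConicConstructible_signRegion h σ)).eulerChar_eq (hc.inter_signRegion h σ)

/-! ### The Euler characteristic of closed polyhedral cones -/

lemma IsConicConstructible.eulerChar_inter_nonneg {A : Set E} (hA : IsConicConstructible A)
    (h : E) : eulerChar (A ∩ {x | (0 : ℝ) ≤ inner ℝ x h}) =
      eulerChar (A ∩ signRegion h 1) + eulerChar (A ∩ signRegion h 0) := by
  rw [← (hA.inter (isConicConstructible_nonneg h)).sum_eulerChar h, sum_signType]
  have h1 : A ∩ {x | (0 : ℝ) ≤ inner ℝ x h} ∩ signRegion h 1 = A ∩ signRegion h 1 := by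
    ext x
    simp only [Set.mem_inter_iff, mem_signRegion_one, Set.mem_ofPred_eq]
    exact ⟨fun hx => ⟨hx.1.1, hx.2⟩, fun hx => ⟨⟨hx.1, hx.2.le⟩, hx.2⟩⟩
  have h2 : A ∩ {x | (0 : ℝ) ≤ inner ℝ x h} ∩ signRegion h 0 = A ∩ signRegion h 0 := by
    ext x
    simp only [Set.mem_inter_iff, mem_signRegion_zero, Set.mem_ofPred_eq]
    exact ⟨fun hx => ⟨hx.1.1, hx.2⟩, fun hx => ⟨⟨hx.1, hx.2.ge⟩, hx.2⟩⟩
  have h3 : A ∩ {x | (0 : ℝ) ≤ inner ℝ x h} ∩ signRegion h (-1) = ∅ := by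
    ext x
    simp only [Set.mem_inter_iff, mem_signRegion_neg_one, Set.mem_ofPred_eq,
      Set.mem_empty_iff_false, iff_false, not_and, not_lt]
    exact fun hx => hx.2
  rw [h1, h2, h3, eulerChar_empty, add_zero]

/-- Every line in direction `v` meets the set in question in a closed halfline, whose Euler
characteristic with compact supports vanishes. -/
lemma eulerChar_inter_nonneg_eq_zero {v h : E} (hvh : (inner ℝ v h : ℝ) = 1) {l : List E}
    (hlv : ∀ k ∈ l, (inner ℝ v k : ℝ) = 0) {A : Set E} (hA : SignDetermined l Set.univ A) :
    eulerChar (A ∩ {x | (0 : ℝ) ≤ inner ℝ x h}) = 0 := by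
  have key := hA.induction
    (p := fun X => IsConicConstructible X → eulerChar (X ∩ {x | (0 : ℝ) ≤ inner ℝ x h}) = 0)
    (q := fun P => IsCell P ∧ ∀ x ∈ P, ∀ t : ℝ, x + t • v ∈ P)
    ⟨isCell_univ, fun _ _ _ => Set.mem_univ _⟩ ?_ ?_ ?_ ?_
  · rw [Set.univ_inter] at key
    exact key ⟨l, hA⟩
  · rintro P ⟨hP, hPv⟩ k hk σ
    refine ⟨hP.inter_signRegion k σ, fun x hx t => ⟨hPv x hx.1 t, ?_⟩⟩
    rw [mem_signRegion, inner_add_left, real_inner_smul_left, hlv k hk, mul_zero, add_zero]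
    exact hx.2
  · simp
  · rintro P ⟨hP, hPv⟩ hP'
    rcases P.eq_empty_or_nonempty with rfl | ⟨x, hx⟩
    · simp
    have hy := hPv x hx (-inner ℝ x h)
    have hyh : (inner ℝ (x + (-inner ℝ x h : ℝ) • v) h : ℝ) = 0 := by
      rw [inner_add_left, real_inner_smul_left, hvh]; ring
    generalize x + (-inner ℝ x h : ℝ) • v = y at hy hyh
    have hyv := hPv y hy 1
    obtain ⟨W, O, hO, -, rfl⟩ := id hP
    have hv : v ∈ W := by simpa using W.sub_mem hyv.1 hy.1
    obtain ⟨h₁, -, h₂⟩ := cellSign_split_of_mem hO hv (by rw [hvh]; exact one_ne_zero)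
      hy hyh
    rw [hP'.eulerChar_inter_nonneg,
      (hP.inter_signRegion h 1).eulerChar_eq (hP'.inter (isConicConstructible_signRegion h 1)),
      (hP.inter_signRegion h 0).eulerChar_eq (hP'.inter (isConicConstructible_signRegion h 0)),
      h₂, hP.cellSign_inter_signRegion (by decide) h₁, add_neg_cancel]
  · intro X k hk hX hX'
    rw [← (hX'.inter (isConicConstructible_nonneg h)).sum_eulerChar k]
    refine Finset.sum_eq_zero fun σ _ => ?_
    rw [Set.inter_right_comm]
    exact hX σ (hX'.inter (isConicConstructible_signRegion k σ))

/-- Induction on the number of halfspaces: on either side of the hyperplane `a - b = 0`, one of the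
constraints `0 ≤ a` and `0 ≤ b` implies the other. -/
lemma eulerChar_inter_forall_nonneg_eq_zero {v : E} {s : Finset E} (hs : s.Nonempty)
    (hvs : ∀ h ∈ s, (inner ℝ v h : ℝ) = 1) {l : List E}
    (hlv : ∀ k ∈ l, (inner ℝ v k : ℝ) = 0) {A : Set E} (hA : SignDetermined l Set.univ A) :
    eulerChar (A ∩ {x | ∀ h ∈ s, (0 : ℝ) ≤ inner ℝ x h}) = 0 := by
  classical
  induction hm : s.card generalizing s l A with
  | zero => exact absurd (Finset.card_eq_zero.1 hm) hs.ne_empty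
  | succ m ih =>
    by_cases hone : ∃ h, s = {h}
    · obtain ⟨h, rfl⟩ := hone
      simpa using eulerChar_inter_nonneg_eq_zero (hvs h (by simp)) hlv hA
    obtain ⟨a, ha⟩ := id hs
    obtain ⟨b, hb, hba⟩ : ∃ b ∈ s, b ≠ a := by
      by_contra! hcon
      exact hone ⟨a, Finset.eq_singleton_iff_unique_mem.2 ⟨ha, hcon⟩⟩
    have hX : IsConicConstructible {x : E | ∀ h ∈ s, (0 : ℝ) ≤ inner ℝ x h} := by
      refine ⟨s.toList, fun x _ y _ hxy => forall₂_congr fun u hu => ?_⟩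
      rw [← sign_nonneg_iff, hxy u (Finset.mem_toList.2 hu), sign_nonneg_iff]
    have hlv' : ∀ k ∈ (a - b) :: l, (inner ℝ v k : ℝ) = 0 := by
      intro k hk
      rcases List.mem_cons.1 hk with rfl | hk
      · rw [inner_sub_right, hvs a ha, hvs b hb, sub_self]
      · exact hlv k hk
    have hA' : ∀ σ, SignDetermined ((a - b) :: l) Set.univ (A ∩ signRegion (a - b) σ) := fun σ =>
      (hA.mono (List.subset_cons_self _ _) subset_rfl).inter
        ((signDetermined_signRegion (a - b) σ).mono (by simp) subset_rfl)
    have drop : ∀ c ∈ s, ∀ d ∈ s, d ≠ c → ∀ σ,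
        (∀ x ∈ signRegion (a - b) σ, (inner ℝ x d : ℝ) ≤ inner ℝ x c) →
        eulerChar (A ∩ {x | ∀ h ∈ s, (0 : ℝ) ≤ inner ℝ x h} ∩ signRegion (a - b) σ) = 0 := by
      intro c hc d hd hdc σ hσ
      have heq : A ∩ {x | ∀ h ∈ s, (0 : ℝ) ≤ inner ℝ x h} ∩ signRegion (a - b) σ =
          A ∩ signRegion (a - b) σ ∩ {x | ∀ h ∈ s.erase c, (0 : ℝ) ≤ inner ℝ x h} := by
        ext x
        simp only [Set.mem_inter_iff, Set.mem_ofPred_eq, Finset.mem_erase]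
        constructor
        · rintro ⟨⟨h1, h2⟩, h3⟩
          exact ⟨⟨h1, h3⟩, fun h hh => h2 h hh.2⟩
        · rintro ⟨⟨h1, h3⟩, h2⟩
          refine ⟨⟨h1, fun h hh => ?_⟩, h3⟩
          rcases eq_or_ne h c with rfl | hne
          · exact (h2 d ⟨hdc, hd⟩).trans (hσ x h3)
          · exact h2 h ⟨hne, hh⟩
      rw [heq]
      exact ih ⟨d, Finset.mem_erase.2 ⟨hdc, hd⟩⟩
        (fun h hh => hvs h (Finset.mem_of_mem_erase hh)) hlv' (hA' σ)
        (by rw [Finset.card_erase_of_mem hc, hm]; rfl)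
    rw [← (IsConicConstructible.inter ⟨l, hA⟩ hX).sum_eulerChar (a - b), sum_signType,
      drop a ha b hb hba 1, drop a ha b hb hba 0, drop b hb a ha hba.symm (-1)]
    · simp
    · intro x hx
      rw [mem_signRegion_neg_one, inner_sub_right] at hx
      linarith
    · intro x hx
      rw [mem_signRegion_zero, inner_sub_right] at hx
      linarith
    · intro x hx
      rw [mem_signRegion_one, inner_sub_right] at hx
      linarith

/-- A closed polyhedral cone that is not a linear subspace has Euler characteristic with compact
supports `0`. -/
lemma eulerChar_halfSpaces_eq_zero {s : Finset E} {v : E}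
    (hv : ∀ u ∈ s, (inner ℝ v u : ℝ) ≤ 0) (hv' : ∃ u ∈ s, (inner ℝ v u : ℝ) ≠ 0) :
    eulerChar {x | ∀ u ∈ s, (inner ℝ x u : ℝ) ≤ 0} = 0 := by
  classical
  -- the halfspaces not parallel to `v`, rescaled so that `v` has inner product `1` with the normals
  let t : Finset E := (s.filter fun u => (inner ℝ v u : ℝ) ≠ 0).image
    fun u => (inner ℝ v u : ℝ)⁻¹ • u
  have ht : t.Nonempty := by
    obtain ⟨u, hu, huv⟩ := hv'
    exact ⟨_, Finset.mem_image_of_mem _ (Finset.mem_filter.2 ⟨hu, huv⟩)⟩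
  have hvt : ∀ h ∈ t, (inner ℝ v h : ℝ) = 1 := by
    intro h hh
    obtain ⟨u, hu, rfl⟩ := Finset.mem_image.1 hh
    rw [real_inner_smul_right, inv_mul_cancel₀ (Finset.mem_filter.1 hu).2]
  have h0 := eulerChar_inter_forall_nonneg_eq_zero ht hvt
    (l := (s.filter fun u => (inner ℝ v u : ℝ) = 0).toList)
    (fun k hk => (Finset.mem_filter.1 (Finset.mem_toList.1 hk)).2)
    (signDetermined_halfSpaces (s.filter fun u => (inner ℝ v u : ℝ) = 0))
  refine Eq.trans (congrArg eulerChar ?_) h0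
  ext x
  have hneg : ∀ u ∈ s, (inner ℝ v u : ℝ) ≠ 0 →
      (0 ≤ (inner ℝ v u : ℝ)⁻¹ * inner ℝ x u ↔ (inner ℝ x u : ℝ) ≤ 0) := by
    intro u hu hne
    have hlt : (inner ℝ v u : ℝ)⁻¹ < 0 := inv_lt_zero.2 (lt_of_le_of_ne (hv u hu) hne)
    exact ⟨fun h => by nlinarith, fun h => mul_nonneg_of_nonpos_of_nonpos hlt.le h⟩
  simp only [Set.mem_inter_iff, Set.mem_ofPred_eq, Finset.mem_filter, t, Finset.forall_mem_image,
    real_inner_smul_right]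
  constructor
  · intro h
    exact ⟨fun u hu => h u hu.1, fun u hu => (hneg u hu.1 hu.2).2 (h u hu.1)⟩
  · rintro ⟨h1, h2⟩ u hu
    by_cases huv : (inner ℝ v u : ℝ) = 0
    · exact h1 u ⟨hu, huv⟩
    · exact (hneg u hu huv).1 (h2 ⟨hu, huv⟩)

end EulerCharacteristic

variable {n : ℕ} {C D : Set (EuclideanSpace ℝ (Fin n))}

/-! ### Relative interiors and faces of polyhedral cones -/

lemma isConicConstructible_of_isPolyhedralCone (hC : IsPolyhedralCone C) :
    IsConicConstructible C := by
  obtain ⟨s, -, rfl⟩ := hC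
  exact isConicConstructible_halfSpaces s

lemma IsPolyhedralCone.inter (hC : IsPolyhedralCone C) (hD : IsPolyhedralCone D) :
    IsPolyhedralCone (C ∩ D) := by
  classical
  obtain ⟨s, hs, rfl⟩ := hC
  obtain ⟨t, ht, rfl⟩ := hD
  refine ⟨s ∪ t, fun u hu => (Finset.mem_union.1 hu).elim (hs u) (ht u), ?_⟩
  ext x
  simp only [Set.mem_inter_iff, Set.mem_ofPred_eq, Finset.mem_union, or_imp, forall_and]

lemma IsPolyhedralCone.zero_mem (hC : IsPolyhedralCone C) : 0 ∈ C := by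
  obtain ⟨s, -, rfl⟩ := hC
  intro u _
  simp

lemma IsPolyhedralCone.add_mem (hC : IsPolyhedralCone C) {x y : EuclideanSpace ℝ (Fin n)}
    (hx : x ∈ C) (hy : y ∈ C) : x + y ∈ C := by
  obtain ⟨s, -, rfl⟩ := hC
  intro u hu
  rw [inner_add_left]
  exact add_nonpos (hx u hu) (hy u hu)

lemma IsPolyhedralCone.smul_mem (hC : IsPolyhedralCone C) {x : EuclideanSpace ℝ (Fin n)}
    (hx : x ∈ C) {c : ℝ} (hc : 0 ≤ c) : c • x ∈ C := by
  obtain ⟨s, -, rfl⟩ := hC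
  intro u hu
  rw [real_inner_smul_left]
  exact mul_nonpos_of_nonneg_of_nonpos hc (hx u hu)

/-- The relative interior of a convex cone, described algebraically: from its points one can move a
little away from each point of the cone without leaving the cone. -/
def conicRelint (C : Set (EuclideanSpace ℝ (Fin n))) : Set (EuclideanSpace ℝ (Fin n)) :=
  {x | x ∈ C ∧ ∀ y ∈ C, ∃ ε : ℝ, 0 < ε ∧ x - ε • y ∈ C}

lemma exists_pos_forall_sub_mul_nonpos {ι : Type*} (s : Finset ι) {f : ι → ℝ} (g : ι → ℝ)
    (hf : ∀ i ∈ s, f i < 0) : ∃ ε : ℝ, 0 < ε ∧ ∀ i ∈ s, f i - ε * g i ≤ 0 := by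
  have h : ∀ᶠ ε : ℝ in nhdsWithin 0 (Set.Ioi 0), ∀ i ∈ s, f i - ε * g i ≤ 0 := by
    refine (Filter.eventually_all_finset s).2 fun i hi => ?_
    have hc : ContinuousAt (fun ε : ℝ => f i - ε * g i) 0 := by fun_prop
    have := hc.eventually_lt continuousAt_const (show f i - 0 * g i < 0 by simpa using hf i hi)
    exact nhdsWithin_le_nhds (this.mono fun ε hε => hε.le)
  obtain ⟨ε, h2, h1⟩ := (h.and self_mem_nhdsWithin).exists
  exact ⟨ε, h1, h2⟩

open Classical in
/-- In the relative interior of a polyhedral cone, each of the inequalities defining the cone is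
either strict or an equation on the whole cone. -/
lemma conicRelint_eq_biInter (s : Finset (EuclideanSpace ℝ (Fin n))) :
    conicRelint {x | ∀ u ∈ s, inner ℝ x u ≤ 0} = ⋂ u ∈ s, signRegion u
      (if ∀ y ∈ {x | ∀ u ∈ s, inner ℝ x u ≤ 0}, inner ℝ y u = 0 then 0 else -1) := by
  ext x
  simp only [Set.mem_iInter]
  constructor
  · rintro ⟨hx, hx'⟩ u hu
    split_ifs with h
    · exact mem_signRegion_zero.2 (h x hx)
    · push Not at h
      obtain ⟨y, hy, hyu⟩ := h
      obtain ⟨ε, hε, hxy⟩ := hx' y hy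
      have h1 := hxy u hu
      rw [inner_sub_left, real_inner_smul_left] at h1
      have h2 : inner ℝ y u < 0 := lt_of_le_of_ne (hy u hu) hyu
      exact mem_signRegion_neg_one.2 (by nlinarith)
  · intro hx
    refine ⟨fun u hu => ?_, fun y hy => ?_⟩
    · have h1 := hx u hu
      split_ifs at h1
      · exact (mem_signRegion_zero.1 h1).le
      · exact (mem_signRegion_neg_one.1 h1).le
    · obtain ⟨ε, hε, hlt⟩ := exists_pos_forall_sub_mul_nonpos
        (s.filter fun u => inner ℝ x u < 0) (f := fun u => inner ℝ x u) (fun u => inner ℝ y u)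
        fun u hu => (Finset.mem_filter.1 hu).2
      refine ⟨ε, hε, fun u hu => ?_⟩
      rw [inner_sub_left, real_inner_smul_left]
      have h1 := hx u hu
      split_ifs at h1 with h2
      · rw [mem_signRegion_zero.1 h1, h2 y hy]; simp
      · exact hlt u (Finset.mem_filter.2 ⟨hu, mem_signRegion_neg_one.1 h1⟩)

lemma isCell_biInter_signRegion {E : Type*} [NormedAddCommGroup E] [InnerProductSpace ℝ E]
    (s : Finset E) (τ : E → SignType) : IsCell (⋂ u ∈ s, signRegion u (τ u)) := by
  classical
  induction s using Finset.induction_on with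
  | empty => simpa using isCell_univ
  | insert a s _ ih =>
    rw [Finset.set_biInter_insert, Set.inter_comm]
    exact ih.inter_signRegion a _

lemma isConicConstructible_biInter_signRegion {E : Type*} [NormedAddCommGroup E]
    [InnerProductSpace ℝ E] (s : Finset E) (τ : E → SignType) :
    IsConicConstructible (⋂ u ∈ s, signRegion u (τ u)) := by
  classical
  induction s using Finset.induction_on with
  | empty => simpa using isConicConstructible_univ
  | insert a s _ ih =>
    rw [Finset.set_biInter_insert]
    exact (isConicConstructible_signRegion a _).inter ih

lemma IsPolyhedralCone.isCell_conicRelint (hC : IsPolyhedralCone C) : IsCell (conicRelint C) := by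
  classical
  obtain ⟨s, -, rfl⟩ := hC
  rw [conicRelint_eq_biInter]
  exact isCell_biInter_signRegion s fun u =>
    if ∀ y ∈ {x | ∀ u ∈ s, inner ℝ x u ≤ 0}, inner ℝ y u = 0 then 0 else -1

lemma IsPolyhedralCone.isConicConstructible_conicRelint (hC : IsPolyhedralCone C) :
    IsConicConstructible (conicRelint C) := by
  classical
  obtain ⟨s, -, rfl⟩ := hC
  rw [conicRelint_eq_biInter]
  exact isConicConstructible_biInter_signRegion s fun u =>
    if ∀ y ∈ {x | ∀ u ∈ s, inner ℝ x u ≤ 0}, inner ℝ y u = 0 then 0 else -1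

/-- The sum of one point of the cone for each inequality, chosen to make that inequality strict if
possible, lies in the relative interior. -/
lemma IsPolyhedralCone.conicRelint_nonempty (hC : IsPolyhedralCone C) :
    (conicRelint C).Nonempty := by
  classical
  obtain ⟨s, -, rfl⟩ := hC
  have hy : ∀ u : EuclideanSpace ℝ (Fin n), ∃ y ∈ {x | ∀ u ∈ s, inner ℝ x u ≤ 0},
      (¬ ∀ y ∈ {x | ∀ u ∈ s, inner ℝ x u ≤ 0}, inner ℝ y u = 0) → inner ℝ y u ≠ 0 := by
    intro u
    by_cases h : ∀ y ∈ {x | ∀ u ∈ s, inner ℝ x u ≤ 0}, inner ℝ y u = 0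
    · exact ⟨0, fun u _ => by simp, fun h' => absurd h h'⟩
    · push Not at h
      obtain ⟨y, hy, hyu⟩ := h
      exact ⟨y, hy, fun _ => hyu⟩
  choose y hyC hyu using hy
  have hsum : ∀ u ∈ s, inner ℝ (∑ v ∈ s, y v) u ≤ 0 := by
    intro u hu
    rw [sum_inner]
    exact Finset.sum_nonpos fun v _ => hyC v u hu
  refine ⟨∑ v ∈ s, y v, ?_⟩
  rw [conicRelint_eq_biInter, Set.mem_iInter₂]
  intro u hu
  split_ifs with h
  · exact mem_signRegion_zero.2 (h _ hsum)
  · rw [mem_signRegion_neg_one, sum_inner]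
    exact Finset.sum_neg' (fun v _ => hyC v u hu) ⟨u, hu, lt_of_le_of_ne (hyC u u hu) (hyu u h)⟩

lemma IsPolyhedralCone.add_smul_mem_conicRelint (hC : IsPolyhedralCone C)
    {x y : EuclideanSpace ℝ (Fin n)} (hx : x ∈ conicRelint C) (hy : y ∈ C) {c : ℝ} (hc : 0 < c) :
    y + c • x ∈ conicRelint C := by
  refine ⟨hC.add_mem hy (hC.smul_mem hx.1 hc.le), fun z hz => ?_⟩
  obtain ⟨ε, hε, hxz⟩ := hx.2 z hz
  refine ⟨c * ε, by positivity, ?_⟩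
  have h := hC.add_mem hy (hC.smul_mem hxz hc.le)
  rwa [smul_sub, smul_smul, ← add_sub_assoc] at h

lemma IsPolyhedralCone.span_conicRelint (hC : IsPolyhedralCone C) :
    Submodule.span ℝ (conicRelint C) = Submodule.span ℝ C := by
  apply le_antisymm (Submodule.span_mono fun x hx => hx.1)
  rw [Submodule.span_le]
  intro y hy
  obtain ⟨x, hx⟩ := hC.conicRelint_nonempty
  have h := Submodule.sub_mem (Submodule.span ℝ (conicRelint C))
    (Submodule.subset_span (hC.add_smul_mem_conicRelint hx hy one_pos)) (Submodule.subset_span hx)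
  simpa using h

lemma IsPolyhedralCone.cellSign_conicRelint (hC : IsPolyhedralCone C) :
    cellSign (conicRelint C) = (-1) ^ coneDim C := by
  rw [cellSign_of_nonempty hC.conicRelint_nonempty, hC.span_conicRelint, coneDim]

lemma IsPolyhedralCone.dualCone_conicRelint (hC : IsPolyhedralCone C) :
    dualCone (conicRelint C) = dualCone C := by
  apply Set.Subset.antisymm
  · intro u hu y hy
    obtain ⟨x, hx⟩ := hC.conicRelint_nonempty
    have hc : ContinuousWithinAt (fun ε : ℝ => inner ℝ u (y + ε • x)) (Set.Ioi 0) 0 := by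
      fun_prop
    have := le_of_tendsto hc (Filter.eventually_of_mem self_mem_nhdsWithin
      fun ε hε => hu _ (hC.add_smul_mem_conicRelint hx hy hε))
    simpa using this
  · exact fun u hu y hy => hu y hy.1

/-- Each point of a polyhedral cone lies in the relative interior of the face cut out by the
inequalities which are equations at this point. -/
lemma IsPolyhedralCone.exists_isFace_mem_conicRelint (hC : IsPolyhedralCone C)
    {x : EuclideanSpace ℝ (Fin n)} (hx : x ∈ C) : ∃ F, IsFace C F ∧ x ∈ conicRelint F := by
  classical
  obtain ⟨s, -, rfl⟩ := hC
  let t := s.filter fun u => inner ℝ x u = 0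
  let F : Set (EuclideanSpace ℝ (Fin n)) :=
    {z | (∀ u ∈ s, inner ℝ z u ≤ 0) ∧ ∀ u ∈ t, inner ℝ z u = 0}
  have hxF : x ∈ F := ⟨hx, fun u hu => (Finset.mem_filter.1 hu).2⟩
  refine ⟨F, ⟨⟨x, hxF⟩, fun _ => ⟨innerSL ℝ (∑ u ∈ t, u), ?_⟩⟩, hxF, fun y hy => ?_⟩
  · ext z
    simp only [Set.mem_ofPred_eq, innerSL_apply_apply, sum_inner, F]
    have hnonpos : ∀ y : EuclideanSpace ℝ (Fin n), (∀ u ∈ s, inner ℝ y u ≤ 0) →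
        ∀ u ∈ t, inner ℝ u y ≤ 0 := fun y hy u hu => by
      rw [real_inner_comm]; exact hy u (Finset.mem_filter.1 hu).1
    refine and_congr_right fun hz => ⟨fun h y hy => ?_, fun h => ?_⟩
    · rw [Finset.sum_eq_zero (f := fun u => inner ℝ u z)
        fun u hu => by rw [real_inner_comm]; exact h u hu]
      exact Finset.sum_nonpos (hnonpos y hy)
    · have h1 := h x hx
      rw [Finset.sum_eq_zero (f := fun u => inner ℝ u x)
        fun u hu => by rw [real_inner_comm]; exact hxF.2 u hu] at h1
      have h2 := (Finset.sum_eq_zero_iff_of_nonpos (hnonpos z hz)).1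
        (le_antisymm (Finset.sum_nonpos (hnonpos z hz)) h1)
      intro u hu
      rw [real_inner_comm]
      exact h2 u hu
  · obtain ⟨ε, hε, hlt⟩ := exists_pos_forall_sub_mul_nonpos
      (s.filter fun u => inner ℝ x u < 0) (f := fun u => inner ℝ x u) (fun u => inner ℝ y u)
      fun u hu => (Finset.mem_filter.1 hu).2
    have heq : ∀ u ∈ t, inner ℝ (x - ε • y) u = 0 := fun u hu => by
      rw [inner_sub_left, real_inner_smul_left, hxF.2 u hu, hy.2 u hu]; simp
    refine ⟨ε, hε, fun u hu => ?_, heq⟩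
    rcases (hx u hu).lt_or_eq with h | h
    · rw [inner_sub_left, real_inner_smul_left]
      exact hlt u (Finset.mem_filter.2 ⟨hu, h⟩)
    · exact (heq u (Finset.mem_filter.2 ⟨hu, h⟩)).le

/-- A face meeting the relative interior of a cone is the whole cone. -/
lemma IsPolyhedralCone.subset_of_isFace (hC : IsPolyhedralCone C)
    {F : Set (EuclideanSpace ℝ (Fin n))} (hF : IsFace C F) {x : EuclideanSpace ℝ (Fin n)}
    (hx : x ∈ conicRelint C) (hxF : x ∈ F) : C ⊆ F := by
  obtain ⟨hne, hexp⟩ := hF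
  obtain ⟨l, rfl⟩ := hexp hne
  intro y hy
  refine ⟨hy, fun z hz => (hxF.2 z hz).trans ?_⟩
  obtain ⟨ε, hε, hxy⟩ := hx.2 y hy
  -- a linear functional bounded above on a cone is nonpositive there
  have h1 := hxF.2 _ (hC.add_mem hx.1 hx.1)
  have h2 := hxF.2 _ hC.zero_mem
  have h3 := hxF.2 _ hxy
  simp only [map_add, map_zero, map_sub, map_smul, smul_eq_mul] at h1 h2 h3
  nlinarith

lemma ConicCellComplex.eq_of_mem_conicRelint (Z : ConicCellComplex n) (hC : C ∈ Z.cells)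
    (hD : D ∈ Z.cells) {x : EuclideanSpace ℝ (Fin n)} (hx : x ∈ conicRelint C)
    (hx' : x ∈ conicRelint D) : C = D := by
  obtain ⟨h1, h2⟩ := Z.inter_isFace C hC D hD
  apply Set.Subset.antisymm
  · exact ((Z.isPolyhedralCone C hC).subset_of_isFace h1 hx ⟨hx.1, hx'.1⟩).trans
      Set.inter_subset_right
  · exact ((Z.isPolyhedralCone D hD).subset_of_isFace h2 hx' ⟨hx.1, hx'.1⟩).trans
      Set.inter_subset_left

lemma ConicCellComplex.carrier_eq (Z : ConicCellComplex n) :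
    Z.carrier = ⋃ C ∈ Z.cells, conicRelint C := by
  apply Set.Subset.antisymm
  · intro x hx
    obtain ⟨C, hC, hxC⟩ := Set.mem_iUnion₂.1 hx
    obtain ⟨F, hF, hxF⟩ := (Z.isPolyhedralCone C hC).exists_isFace_mem_conicRelint hxC
    exact Set.mem_iUnion₂.2 ⟨F, Z.face_mem C hC F hF, hxF⟩
  · exact Set.iUnion₂_mono fun C _ x hx => hx.1

/-! ### The Euler characteristic of the part of a cone in a halfspace -/

lemma eulerChar_cell_inter_nonneg {P : Set (EuclideanSpace ℝ (Fin n))} (hP : IsCell P)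
    (hP' : IsConicConstructible P) (u : EuclideanSpace ℝ (Fin n)) :
    eulerChar (P ∩ {x | 0 ≤ inner ℝ x u}) =
      (dualCone P).indicator (fun _ => cellSign P) (-u) := by
  have h1 := hP'.sum_eulerChar u
  have h2 := hP'.eulerChar_inter_nonneg u
  rw [sum_signType, ← h2, hP.eulerChar_eq hP', (hP.inter_signRegion u (-1)).eulerChar_eq
    (hP'.inter (isConicConstructible_signRegion u (-1)))] at h1
  by_cases hu : -u ∈ dualCone P
  · have hempty : P ∩ signRegion u (-1) = ∅ := by
      refine Set.eq_empty_of_forall_notMem fun x hx => ?_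
      have h3 := hu x hx.1
      have h4 := mem_signRegion_neg_one.1 hx.2
      rw [inner_neg_left, real_inner_comm] at h3
      linarith
    rw [Set.indicator_of_mem hu]
    rwa [hempty, cellSign_empty, add_zero] at h1
  · have hne : (P ∩ signRegion u (-1)).Nonempty := by
      simp only [dualCone, Set.mem_ofPred_eq, not_forall, not_le, inner_neg_left] at hu
      obtain ⟨x, hx, hxu⟩ := hu
      refine ⟨x, hx, mem_signRegion_neg_one.2 ?_⟩
      rw [real_inner_comm]
      linarith
    rw [Set.indicator_of_notMem hu]
    rw [hP.cellSign_inter_signRegion (by decide) hne] at h1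
    linarith

lemma isClosed_dualCone (C : Set (EuclideanSpace ℝ (Fin n))) : IsClosed (dualCone C) := by
  have : dualCone C = ⋂ y ∈ C, {x | inner ℝ x y ≤ 0} := by
    ext x; simp [dualCone]
  rw [this]
  exact isClosed_biInter fun y _ => isClosed_le (by fun_prop) continuous_const

lemma convex_dualCone (C : Set (EuclideanSpace ℝ (Fin n))) : Convex ℝ (dualCone C) := by
  intro x hx y hy a b ha hb _ z hz
  rw [inner_add_left, real_inner_smul_left, real_inner_smul_left]
  exact add_nonpos (mul_nonpos_of_nonneg_of_nonpos ha (hx z hz))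
    (mul_nonpos_of_nonneg_of_nonpos hb (hy z hz))

lemma smul_mem_dualCone {x : EuclideanSpace ℝ (Fin n)} (hx : x ∈ dualCone C) {c : ℝ}
    (hc : 0 ≤ c) : c • x ∈ dualCone C := fun y hy => by
  rw [real_inner_smul_left]
  exact mul_nonpos_of_nonneg_of_nonpos hc (hx y hy)

/-- If a vector of the dual cone is orthogonal to a nonzero vector `x` of the cone, then it becomes
a vector outside of the dual cone by adding a small multiple of `x`. -/
lemma mem_frontier_dualCone {x u : EuclideanSpace ℝ (Fin n)} (hu : u ∈ dualCone C) (hx : x ∈ C)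
    (hx0 : x ≠ 0) (hux : inner ℝ u x = 0) : u ∈ frontier (dualCone C) := by
  rw [(isClosed_dualCone C).frontier_eq]
  refine ⟨hu, fun hint => ?_⟩
  have hc : ContinuousWithinAt (fun ε : ℝ => u + ε • x) (Set.Ioi 0) 0 := by fun_prop
  have hmem := hc.tendsto.eventually
    (mem_interior_iff_mem_nhds.1 (by simpa using hint) : dualCone C ∈ nhds (u + (0 : ℝ) • x))
  obtain ⟨ε, hε, h⟩ := (hmem.and self_mem_nhdsWithin).exists
  have h1 := hε x hx
  rw [inner_add_left, hux, real_inner_smul_left, real_inner_self_eq_norm_sq] at h1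
  have h2 : 0 < ‖x‖ := norm_pos_iff.2 hx0
  have h3 : 0 < ε * ‖x‖ ^ 2 := mul_pos h (by positivity)
  linarith

/-- If `u` is in the dual cone, the part of `C` in the halfspace is `{0}` for generic `u`; otherwise
it is a cone containing a vector `v` with `0 < ⟨v, u⟩`, so it is not a linear subspace. -/
lemma IsPolyhedralCone.eulerChar_inter_nonneg (hC : IsPolyhedralCone C)
    {u : EuclideanSpace ℝ (Fin n)} (hu : u ∉ frontier (dualCone C)) :
    eulerChar (C ∩ {x | 0 ≤ inner ℝ x u}) = (dualCone C).indicator (fun _ => 1) u := by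
  classical
  by_cases hmem : u ∈ dualCone C
  · have hzero : C ∩ {x | 0 ≤ inner ℝ x u} = {0} := by
      refine Set.eq_singleton_iff_unique_mem.2 ⟨⟨hC.zero_mem, by simp⟩, fun x hx => ?_⟩
      by_contra hx0
      refine hu (mem_frontier_dualCone hmem hx.1 hx0 (le_antisymm (hmem x hx.1) ?_))
      rw [real_inner_comm]
      exact hx.2
    rw [hzero, eulerChar_zero, Set.indicator_of_mem hmem]
  · rw [Set.indicator_of_notMem hmem]
    simp only [dualCone, Set.mem_ofPred_eq, not_forall, not_le] at hmem
    obtain ⟨v, hv, huv⟩ := hmem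
    obtain ⟨s, -, rfl⟩ := hC
    have heq : {x | ∀ w ∈ s, inner ℝ x w ≤ 0} ∩ {x | 0 ≤ inner ℝ x u} =
        {x | ∀ w ∈ insert (-u) s, inner ℝ x w ≤ 0} := by
      ext x
      simp only [Set.mem_inter_iff, Set.mem_ofPred_eq, Finset.forall_mem_insert, inner_neg_right,
        neg_nonpos]
      tauto
    have hvu : inner ℝ v (-u) < 0 := by rw [inner_neg_right, real_inner_comm]; linarith
    rw [heq]
    exact eulerChar_halfSpaces_eq_zero (v := v)
      ((Finset.forall_mem_insert _ _ _).2 ⟨hvu.le, hv⟩)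
      ⟨-u, Finset.mem_insert_self _ _, hvu.ne⟩

/-! ### The spherical measure -/

lemma isFiniteMeasure_sphereMeasure (hn : 1 ≤ n) : IsFiniteMeasure (sphereMeasure n) := by
  have : Nonempty (Fin n) := ⟨⟨0, hn⟩⟩
  refine Measure.smul_finite _ (ENNReal.inv_ne_top.2 ?_)
  rw [Ne, Measure.measure_univ_eq_zero]
  exact Measure.toSphere_ne_zero _

lemma measurableSet_sphere_dualCone (C : Set (EuclideanSpace ℝ (Fin n))) :
    MeasurableSet {u : Metric.sphere (0 : EuclideanSpace ℝ (Fin n)) 1 |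
      (u : EuclideanSpace ℝ (Fin n)) ∈ dualCone C} :=
  measurable_subtype_coe (isClosed_dualCone C).measurableSet

lemma measurableSet_sphere_neg_dualCone (C : Set (EuclideanSpace ℝ (Fin n))) :
    MeasurableSet {u : Metric.sphere (0 : EuclideanSpace ℝ (Fin n)) 1 |
      -(u : EuclideanSpace ℝ (Fin n)) ∈ dualCone C} :=
  measurable_subtype_coe.neg (isClosed_dualCone C).measurableSet

open Pointwise in
lemma ae_notMem_frontier_dualCone (C : Set (EuclideanSpace ℝ (Fin n))) :
    ∀ᵐ u : Metric.sphere (0 : EuclideanSpace ℝ (Fin n)) 1 ∂sphereMeasure n,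
      (u : EuclideanSpace ℝ (Fin n)) ∉ frontier (dualCone C) := by
  have hmeas : MeasurableSet {u : Metric.sphere (0 : EuclideanSpace ℝ (Fin n)) 1 |
      (u : EuclideanSpace ℝ (Fin n)) ∈ frontier (dualCone C)} :=
    measurable_subtype_coe isClosed_frontier.measurableSet
  refine Measure.ae_smul_measure ?_ _
  simp only [ae_iff, not_not]
  rw [Measure.toSphere_apply' _ hmeas]
  refine mul_eq_zero_of_right _ (measure_mono_null ?_
    ((convex_dualCone C).addHaar_frontier volume))
  rintro _ ⟨r, hr, _, ⟨u, hu, rfl⟩, rfl⟩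
  have hscale : ∀ c : ℝ, 0 < c → ∀ x, x ∈ dualCone C → c • x ∈ dualCone C := fun c hc x hx =>
    smul_mem_dualCone hx hc.le
  have hr0 : r ≠ 0 := hr.1.ne'
  have heq : r • dualCone C = dualCone C := by
    apply Set.Subset.antisymm
    · rintro _ ⟨x, hx, rfl⟩
      exact hscale r hr.1 x hx
    · intro x hx
      exact ⟨r⁻¹ • x, hscale _ (inv_pos.2 hr.1) x hx, by
        simp [smul_smul, mul_inv_cancel₀ hr0]⟩
  simp only [Set.mem_ofPred_eq] at hu
  rw [(isClosed_dualCone C).frontier_eq] at hu ⊢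
  refine ⟨hscale r hr.1 _ hu.1, fun hint => hu.2 ?_⟩
  rw [← heq, interior_smul₀ hr0] at hint
  exact (Set.smul_mem_smul_set_iff₀ hr0 _ _).1 hint

open Pointwise in
lemma sphereMeasure_real_neg_dualCone (C : Set (EuclideanSpace ℝ (Fin n))) :
    (sphereMeasure n).real {u | -(u : EuclideanSpace ℝ (Fin n)) ∈ dualCone C} = outerAngle C := by
  rw [outerAngle, measureReal_def, measureReal_def]
  congr 1
  simp only [sphereMeasure, Measure.smul_apply]
  rw [Measure.toSphere_apply' _ (measurableSet_sphere_dualCone C),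
    Measure.toSphere_apply' _ (measurableSet_sphere_neg_dualCone C),
    ← Measure.measure_neg volume (Set.Ioo (0 : ℝ) 1 • (Subtype.val '' {u :
      Metric.sphere (0 : EuclideanSpace ℝ (Fin n)) 1 |
        (u : EuclideanSpace ℝ (Fin n)) ∈ dualCone C}))]
  congr 3
  ext x
  rw [Set.mem_neg]
  constructor
  · rintro ⟨r, hr, _, ⟨u, hu, rfl⟩, rfl⟩
    exact ⟨r, hr, _, ⟨-u, by simpa using hu, rfl⟩, by simp⟩
  · rintro ⟨r, hr, _, ⟨u, hu, rfl⟩, hx⟩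
    refine ⟨r, hr, _, ⟨-u, by simpa using hu, rfl⟩, ?_⟩
    simpa [neg_eq_iff_eq_neg] using hx

/-! ### The additive extension of the outer angle -/

/-- The additive extension of the outer angle: the spherical mean of the Euler characteristics (with
compact supports) of the parts of a set in closed halfspaces. -/
noncomputable def meanEulerChar (A : Set (EuclideanSpace ℝ (Fin n))) : ℝ :=
  ∫ u : Metric.sphere (0 : EuclideanSpace ℝ (Fin n)) 1,
    eulerChar (A ∩ {x | 0 ≤ inner ℝ x (u : EuclideanSpace ℝ (Fin n))}) ∂sphereMeasure n

lemma IsConicConstructible.integrable_eulerChar (hn : 1 ≤ n)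
    {A : Set (EuclideanSpace ℝ (Fin n))} (hA : IsConicConstructible A) :
    Integrable (fun u : Metric.sphere (0 : EuclideanSpace ℝ (Fin n)) 1 =>
      eulerChar (A ∩ {x | 0 ≤ inner ℝ x (u : EuclideanSpace ℝ (Fin n))})) (sphereMeasure n) := by
  have := isFiniteMeasure_sphereMeasure hn
  obtain ⟨l, hl⟩ := id hA
  have key := hl.induction
    (p := fun X => IsConicConstructible X →
      Integrable (fun u : Metric.sphere (0 : EuclideanSpace ℝ (Fin n)) 1 =>
        eulerChar (X ∩ {x | 0 ≤ inner ℝ x (u : EuclideanSpace ℝ (Fin n))})) (sphereMeasure n))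
    (q := IsCell) isCell_univ (fun P hP k _ σ => hP.inter_signRegion k σ) ?_ ?_ ?_
  · rw [Set.univ_inter] at key
    exact key hA
  · simp
  · intro P hP hP'
    simp only [eulerChar_cell_inter_nonneg hP hP']
    exact (integrable_const (cellSign P)).indicator (measurableSet_sphere_neg_dualCone P)
  · intro X k _ hX hX'
    have hsum : ∀ u : EuclideanSpace ℝ (Fin n), eulerChar (X ∩ {x | 0 ≤ inner ℝ x u}) =
        ∑ σ, eulerChar (X ∩ signRegion k σ ∩ {x | 0 ≤ inner ℝ x u}) := by
      intro u
      rw [← (hX'.inter (isConicConstructible_nonneg u)).sum_eulerChar k]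
      simp only [Set.inter_right_comm]
    simp only [hsum]
    exact integrable_finsetSum _ fun σ _ =>
      hX σ (hX'.inter (isConicConstructible_signRegion k σ))

lemma isConicConstructible_of_mem_finiteUnions {A : Set (EuclideanSpace ℝ (Fin n))}
    (hA : A ∈ finiteUnions (polyhedralCones n)) : IsConicConstructible A := by
  obtain ⟨T, hT, hTC, rfl⟩ := hA
  have h := IsConicConstructible.biUnion hT.toFinset (A := fun C => C) fun C hC =>
    isConicConstructible_of_isPolyhedralCone (hTC (hT.mem_toFinset.1 hC))
  simpa [Set.sUnion_eq_biUnion] using h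

lemma meanEulerChar_union_add_inter (hn : 1 ≤ n) {A B : Set (EuclideanSpace ℝ (Fin n))}
    (hA : IsConicConstructible A) (hB : IsConicConstructible B) :
    meanEulerChar (A ∪ B) + meanEulerChar (A ∩ B) = meanEulerChar A + meanEulerChar B := by
  simp only [meanEulerChar]
  rw [← integral_add ((hA.union hB).integrable_eulerChar hn)
    ((hA.inter hB).integrable_eulerChar hn),
    ← integral_add (hA.integrable_eulerChar hn) (hB.integrable_eulerChar hn)]
  refine integral_congr_ae (Filter.Eventually.of_forall fun u => ?_)
  beta_reduce
  rw [Set.union_inter_distrib_right, Set.inter_inter_distrib_right]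
  exact (hA.inter (isConicConstructible_nonneg _)).eulerChar_union_add_inter
    (hB.inter (isConicConstructible_nonneg _))

lemma IsPolyhedralCone.meanEulerChar_eq (hC : IsPolyhedralCone C) :
    meanEulerChar C = outerAngle C := by
  have h : ∀ᵐ u : Metric.sphere (0 : EuclideanSpace ℝ (Fin n)) 1 ∂sphereMeasure n,
      eulerChar (C ∩ {x | 0 ≤ inner ℝ x (u : EuclideanSpace ℝ (Fin n))}) =
        {u : Metric.sphere (0 : EuclideanSpace ℝ (Fin n)) 1 |
          (u : EuclideanSpace ℝ (Fin n)) ∈ dualCone C}.indicator (fun _ => (1 : ℝ)) u := by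
    filter_upwards [ae_notMem_frontier_dualCone C] with u hu
    exact hC.eulerChar_inter_nonneg hu
  rw [meanEulerChar, integral_congr_ae h,
    integral_indicator_const _ (measurableSet_sphere_dualCone C), outerAngle, smul_eq_mul, mul_one]

lemma IsPolyhedralCone.meanEulerChar_conicRelint (hC : IsPolyhedralCone C) :
    meanEulerChar (conicRelint C) = (-1) ^ coneDim C * outerAngle C := by
  have h : ∀ u : Metric.sphere (0 : EuclideanSpace ℝ (Fin n)) 1,
      eulerChar (conicRelint C ∩ {x | 0 ≤ inner ℝ x (u : EuclideanSpace ℝ (Fin n))}) =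
        {u : Metric.sphere (0 : EuclideanSpace ℝ (Fin n)) 1 |
          -(u : EuclideanSpace ℝ (Fin n)) ∈ dualCone C}.indicator
            (fun _ => (-1 : ℝ) ^ coneDim C) u := by
    intro u
    rw [eulerChar_cell_inter_nonneg hC.isCell_conicRelint hC.isConicConstructible_conicRelint,
      hC.dualCone_conicRelint, hC.cellSign_conicRelint]
    rfl
  simp only [meanEulerChar, h]
  rw [integral_indicator_const _ (measurableSet_sphere_neg_dualCone C),
    sphereMeasure_real_neg_dualCone, smul_eq_mul, mul_comm]

lemma isOuterAngleExtension_meanEulerChar (hn : 1 ≤ n) :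
    IsOuterAngleExtension (meanEulerChar (n := n)) where
  isValuationOn :=
    { union_add_inter := fun _ hA _ hB _ => meanEulerChar_union_add_inter hn
        (isConicConstructible_of_mem_finiteUnions hA) (isConicConstructible_of_mem_finiteUnions hB)
      empty := fun _ => by simp [meanEulerChar] }
  eq_outerAngle := fun _ hC => IsPolyhedralCone.meanEulerChar_eq hC

lemma biUnion_mem_finiteUnions (T : Finset (Set (EuclideanSpace ℝ (Fin n))))
    (hT : ∀ C ∈ T, IsPolyhedralCone C) :
    (⋃ C ∈ T, C) ∈ finiteUnions (polyhedralCones n) :=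
  ⟨T, T.finite_toSet, fun C hC => hT C hC, by simp [Set.sUnion_eq_biUnion]⟩

/-- An additive extension of the outer angle is determined by inclusion-exclusion. -/
lemma IsOuterAngleExtension.eq_biUnion {Γ Γ' : Set (EuclideanSpace ℝ (Fin n)) → ℝ}
    (hΓ : IsOuterAngleExtension Γ) (hΓ' : IsOuterAngleExtension Γ')
    (T : Finset (Set (EuclideanSpace ℝ (Fin n)))) (hT : ∀ C ∈ T, IsPolyhedralCone C) :
    Γ (⋃ C ∈ T, C) = Γ' (⋃ C ∈ T, C) := by
  classical
  induction hm : T.card using Nat.strong_induction_on generalizing T with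
  | _ m ih =>
    subst hm
    rcases T.eq_empty_or_nonempty with rfl | ⟨C, hC⟩
    · have hmem := biUnion_mem_finiteUnions (∅ : Finset (Set (EuclideanSpace ℝ (Fin n)))) (by simp)
      simp only [Finset.notMem_empty, Set.iUnion_of_empty, Set.iUnion_empty] at hmem ⊢
      rw [hΓ.isValuationOn.empty hmem, hΓ'.isValuationOn.empty hmem]
    have hcard : (T.erase C).card < T.card := Finset.card_erase_lt_of_mem hC
    have hT' : ∀ D ∈ T.erase C, IsPolyhedralCone D := fun D hD => hT D (Finset.mem_of_mem_erase hD)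
    have hI : ∀ D ∈ (T.erase C).image (C ∩ ·), IsPolyhedralCone D := by
      intro D hD
      obtain ⟨D', hD', rfl⟩ := Finset.mem_image.1 hD
      exact (hT C hC).inter (hT' D' hD')
    have h1 := ih _ hcard (T.erase C) hT' rfl
    have h2 := ih _ (Finset.card_image_le.trans_lt hcard) _ hI rfl
    have hunion : (⋃ D ∈ T, D) = C ∪ ⋃ D ∈ T.erase C, D := by
      rw [← Finset.set_biUnion_insert C (T.erase C) fun D => D, Finset.insert_erase hC]
    have hinter : (⋃ D ∈ (T.erase C).image (C ∩ ·), D) = C ∩ ⋃ D ∈ T.erase C, D := by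
      rw [Finset.set_biUnion_finset_image, Set.inter_iUnion₂]
    have hCmem : C ∈ finiteUnions (polyhedralCones n) := by
      simpa using biUnion_mem_finiteUnions {C} (by simpa using hT C hC)
    have hTmem := biUnion_mem_finiteUnions T hT
    have hTmem' := biUnion_mem_finiteUnions (T.erase C) hT'
    rw [hinter] at h2
    rw [hunion] at hTmem ⊢
    have h3 := hΓ.isValuationOn.union_add_inter _ hCmem _ hTmem' hTmem
    have h4 := hΓ'.isValuationOn.union_add_inter _ hCmem _ hTmem' hTmem
    rw [hΓ.eq_outerAngle C (hT C hC)] at h3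
    rw [hΓ'.eq_outerAngle C (hT C hC)] at h4
    linarith

/-- The carrier is the disjoint union of the relative interiors of the cells. -/
lemma ConicCellComplex.meanEulerChar_carrier (hn : 1 ≤ n) (Z : ConicCellComplex n) :
    meanEulerChar Z.carrier = ∑ C ∈ Z.cells, (-1 : ℝ) ^ coneDim C * outerAngle C := by
  have hcon : ∀ C ∈ Z.cells, IsConicConstructible (conicRelint C) := fun C hC =>
    (Z.isPolyhedralCone C hC).isConicConstructible_conicRelint
  have h : ∀ u : EuclideanSpace ℝ (Fin n), eulerChar (Z.carrier ∩ {x | 0 ≤ inner ℝ x u}) =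
      ∑ C ∈ Z.cells, eulerChar (conicRelint C ∩ {x | 0 ≤ inner ℝ x u}) := by
    intro u
    rw [Z.carrier_eq, Set.iUnion₂_inter]
    refine eulerChar_biUnion Z.cells
      (fun C hC => (hcon C hC).inter (isConicConstructible_nonneg u)) fun C hC D hD hne => ?_
    exact Set.disjoint_left.2 fun x hx hx' => hne (Z.eq_of_mem_conicRelint hC hD hx.1 hx'.1)
  simp only [meanEulerChar, h]
  rw [integral_finsetSum _ fun C hC => (hcon C hC).integrable_eulerChar hn]
  exact Finset.sum_congr rfl fun C hC => (Z.isPolyhedralCone C hC).meanEulerChar_conicRelint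

end ConicComplex

open ConicComplex in
/-- The outer angle has an additive extension to the finite unions of polyhedral cones, and the
extension `Γ` satisfies `Γ(|Z|) = ∑_{C ∈ Z} (-1)^{dim C} Γ(C)` for every conic cell complex `Z`. -/
theorem lemma4 (n : ℕ) (hn : 1 ≤ n) :
    (∃ Γ : Set (EuclideanSpace ℝ (Fin n)) → ℝ, IsOuterAngleExtension Γ) ∧
    ∀ Γ : Set (EuclideanSpace ℝ (Fin n)) → ℝ, IsOuterAngleExtension Γ →
      ∀ Z : ConicCellComplex n,
        Γ Z.carrier = ∑ C ∈ Z.cells, (-1 : ℝ) ^ coneDim C * Γ C := by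
  refine ⟨⟨meanEulerChar, isOuterAngleExtension_meanEulerChar hn⟩, fun Γ hΓ Z => ?_⟩
  have h := hΓ.eq_biUnion (isOuterAngleExtension_meanEulerChar hn) Z.cells Z.isPolyhedralCone
  refine h.trans ((Z.meanEulerChar_carrier hn).trans (Finset.sum_congr rfl fun C hC => ?_))
  rw [hΓ.eq_outerAngle C (Z.isPolyhedralCone C hC)]
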